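/- Let $(M,d)$ be a complete separable metric space and $\mu$ a Borel probability measure on $M$. For $p\ge 1$ and Borel probability measures $\nu,\rho$ on $M$ let $W_p(\nu,\rho)=\bigl(\inf_\pi\iint_{M\times M} d(x,y)^p\,\pi(dx\,dy)\bigr)^{1/p}\in[0,\infty]$, where the infimum is over all Borel probability measures $\pi$ on $M\times M$ with marginals $\nu$ and $\rho$. Let $\alpha>0$ and suppose that $(M,d,\mu)$ satisfies the transport inequality $T_2(\alpha)$: $$W_2(\nu,\mu)^2\le \frac{2}{\alpha}\,\mathrm{Ent}(\nu\mid\mu),\qquad \mathrm{Ent}(\nu\mid\mu)=\int_M \log\frac{d\nu}{d\mu}\,d\nu,$$ for all Borel probability measures $\nu$ on $M$ of finite relative entropy with respect to $\mu$. For $N\ge 1$ and $\xi=(\xi_1,\dots,\xi_N)\in M^N$ let $L_N^\xi=N^{-1}\sum_{j=1}^N\delta_{\xi_j}$ be the empirical distribution, and let $\mu^{\otimes N}$ be the product measure on $M^N$. Then for $p=1$ and $p=2$ the distance $W_p(L_N^\xi,\mu)$ is finite for every $\xi\in M^N$, it is a $\mu^{\otimes N}$-integrable function of $\xi$, and, with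 $\mathbb{E}W_p(L_N,\mu)=\int_{M^N}W_p(L_N^\xi,\mu)\,\mu^{\otimes N}(d\xi)$, $$\mu^{\otimes N}\Bigl(\bigl\{\xi\in M^N:\ \bigl|W_p(L_N^\xi,\mu)-\mathbb{E}W_p(L_N,\mu)\bigr|>\varepsilon\bigr\}\Bigr)\le 2e^{-N\alpha\varepsilon^2/2}\qquad\text{for all }\varepsilon>0.$$ -/

import Mathlib

open MeasureTheory
open scoped ENNReal

/-- The transport plans between `μ` and `ν`: measures on `M × M` with marginals `μ` and `ν`. -/
def TransportPlans {M : Type*} [MeasurableSpace M] (μ ν : Measure M) : Set (Measure (M × M)) :=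
  {π | π.map Prod.fst = μ ∧ π.map Prod.snd = ν}

/-- The Wasserstein distance `W_p(μ, ν) = (inf_π ∫∫ d(x,y)^p π(dx dy))^(1/p)`, the infimum being
over all transport plans; a priori it may be infinite. -/
noncomputable def wassersteinDist {M : Type*} [MetricSpace M] [MeasurableSpace M]
    (p : ℝ) (μ ν : Measure M) : ℝ≥0∞ :=
  (⨅ π ∈ TransportPlans μ ν, ∫⁻ z, edist z.1 z.2 ^ p ∂π) ^ (1 / p)

/-- The transport inequality `T_2(α)`: `W_2(ν, μ)² ≤ (2/α) Ent(ν | μ)` for all probability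
measures `ν` of finite relative entropy with respect to `μ`. -/
def SatisfiesT2 {M : Type*} [MetricSpace M] [MeasurableSpace M]
    (μ : Measure M) (α : ℝ) : Prop :=
  ∀ ν : Measure M, IsProbabilityMeasure ν → InformationTheory.klDiv ν μ ≠ ∞ →
    wassersteinDist 2 ν μ ^ 2 ≤ ENNReal.ofReal (2 / α) * InformationTheory.klDiv ν μ

/-- The empirical distribution `N⁻¹ ∑ j, δ_{ξ j}` of a sample `ξ ∈ M^N`. -/
noncomputable def empiricalDist {M : Type*} [MeasurableSpace M] {N : ℕ} (ξ : Fin N → M) :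
    Measure M :=
  (N : ℝ≥0∞)⁻¹ • ∑ j, Measure.dirac (ξ j)

/-! Bobkov–Götze duality plus tensorization. Tested on the tilted measures e^{αg/2}μ/Z, T_2(α)
yields ∫ e^{αg/2} dμ ≤ e^{(α/2)∫f dμ} whenever g(x) ≤ f(y) + d(x,y)²
(`SatisfiesT2.infConvolutionInequality`). In this form it passes to products by Fubini with no loss
in the constant (`InfConvolutionInequality.pi`), and it gives every bounded function that is
√L-Lipschitz for the ℓ² product distance a Gaussian moment generating function with variance proxy
L/α, whatever the dimension (`InfConvolutionInequality.integral_exp_le`).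

Letting the mass follow its atom shows that ξ ↦ W_p(L_N^ξ, μ) is N^{-1/2}-Lipschitz for that
distance (`SatisfiesT2.abs_wassersteinDist_empiricalDist_sub_le`), so the proxy is 1/(Nα);
Chernoff's bound on both sides gives the claim, and truncation removes boundedness. Finiteness and
integrability rest on the second moment of μ, which T_2 itself forces to be finite
(`SatisfiesT2.lintegral_edist_sq_ne_top`). -/

/-! ### The dual form of T_2 -/

/-- The dual (infimum-convolution) form of a quadratic-type transport inequality with cost `c`,
for test functions `f` in the class `S`. -/
def InfConvolutionInequality {X : Type*} [MeasurableSpace X]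
    (S : Set (X → ℝ)) (μ : Measure X) (c : X → X → ℝ) (a : ℝ) : Prop :=
  ∀ f ∈ S, ∀ g : X → ℝ, Measurable g → (∃ C, ∀ x, |f x| ≤ C) → (∃ C, ∀ x, |g x| ≤ C) →
    (∀ x y, g x ≤ f y + c x y) → ∫ x, Real.exp (a * g x) ∂μ ≤ Real.exp (a * ∫ x, f x ∂μ)

lemma integrable_of_abs_le {X : Type*} [MeasurableSpace X] {μ : Measure X} [IsFiniteMeasure μ]
    {f : X → ℝ} (hf : Measurable f) (hb : ∃ C, ∀ x, |f x| ≤ C) : Integrable f μ := by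
  obtain ⟨C, hC⟩ := hb
  exact Integrable.of_bound hf.aestronglyMeasurable C (Filter.Eventually.of_forall hC)

lemma exists_abs_exp_mul_le {X : Type*} {g : X → ℝ} (a : ℝ) (hb : ∃ C, ∀ x, |g x| ≤ C) :
    ∃ C, ∀ x, |Real.exp (a * g x)| ≤ C := by
  obtain ⟨C, hC⟩ := hb
  refine ⟨Real.exp (|a| * C), fun x => ?_⟩
  rw [Real.abs_exp, Real.exp_le_exp]
  calc a * g x ≤ |a * g x| := le_abs_self _
    _ = |a| * |g x| := abs_mul _ _
    _ ≤ |a| * C := by gcongr; exact hC x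

lemma ofReal_integral_le_lintegral_ofReal {X : Type*} [MeasurableSpace X] {μ : Measure X}
    {f : X → ℝ} (hf : Integrable f μ) :
    ENNReal.ofReal (∫ x, f x ∂μ) ≤ ∫⁻ x, ENNReal.ofReal (f x) ∂μ := by
  rw [integral_eq_lintegral_pos_part_sub_lintegral_neg_part hf]
  exact (ENNReal.ofReal_le_ofReal (sub_le_self _ ENNReal.toReal_nonneg)).trans
    ENNReal.ofReal_toReal_le

lemma wassersteinDist_two_sq {M : Type*} [MetricSpace M] [MeasurableSpace M] (μ ν : Measure M) :
    wassersteinDist 2 μ ν ^ 2 = ⨅ π ∈ TransportPlans μ ν, ∫⁻ z, edist z.1 z.2 ^ (2 : ℝ) ∂π := by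
  rw [wassersteinDist, ← ENNReal.rpow_natCast, ← ENNReal.rpow_mul]
  norm_num

lemma TransportPlans.isProbabilityMeasure {M : Type*} [MeasurableSpace M] {μ ν : Measure M}
    [IsProbabilityMeasure μ] {π : Measure (M × M)} (hπ : π ∈ TransportPlans μ ν) :
    IsProbabilityMeasure π :=
  ⟨by rw [← measure_univ (μ := μ), ← hπ.1, Measure.map_apply measurable_fst .univ,
    Set.preimage_univ]⟩

/-- The easy half of Kantorovich duality: integrate the pointwise constraint against an arbitrary
plan. -/
lemma ofReal_integral_sub_integral_le_wassersteinDist_sq {M : Type*} [MetricSpace M]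
    [MeasurableSpace M] {μ ν : Measure M} [IsProbabilityMeasure μ] [IsProbabilityMeasure ν]
    {f g : M → ℝ} (hf : Measurable f) (hg : Measurable g) (hfb : ∃ C, ∀ x, |f x| ≤ C)
    (hgb : ∃ C, ∀ x, |g x| ≤ C) (hfg : ∀ x y, g x ≤ f y + dist x y ^ 2) :
    ENNReal.ofReal (∫ x, g x ∂ν - ∫ x, f x ∂μ) ≤ wassersteinDist 2 ν μ ^ 2 := by
  rw [wassersteinDist_two_sq]
  refine le_iInf₂ fun π hπ => ?_
  have := TransportPlans.isProbabilityMeasure hπ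
  have h1 : ∫ x, g x ∂ν = ∫ z, g z.1 ∂π := by
    rw [← hπ.1, integral_map measurable_fst.aemeasurable hg.aestronglyMeasurable]
  have h2 : ∫ x, f x ∂μ = ∫ z, f z.2 ∂π := by
    rw [← hπ.2, integral_map measurable_snd.aemeasurable hf.aestronglyMeasurable]
  have i1 : Integrable (fun z : M × M => g z.1) π :=
    integrable_of_abs_le (hg.comp measurable_fst) (hgb.imp fun C h z => h z.1)
  have i2 : Integrable (fun z : M × M => f z.2) π :=
    integrable_of_abs_le (hf.comp measurable_snd) (hfb.imp fun C h z => h z.2)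
  rw [h1, h2, ← integral_sub i1 i2]
  refine (ofReal_integral_le_lintegral_ofReal (i1.sub i2)).trans (lintegral_mono fun z => ?_)
  rw [edist_dist, ENNReal.ofReal_rpow_of_nonneg dist_nonneg zero_le_two]
  refine ENNReal.ofReal_le_ofReal ?_
  have := hfg z.1 z.2
  rw [Real.rpow_two]
  simp only [Pi.sub_apply]
  linarith

lemma integral_llr_tilted_self {X : Type*} [MeasurableSpace X] {μ : Measure X}
    [IsProbabilityMeasure μ] {h : X → ℝ} (hm : Measurable h) (hb : ∃ C, ∀ x, |h x| ≤ C) :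
    Integrable (llr (μ.tilted h) μ) (μ.tilted h) ∧
    ∫ x, llr (μ.tilted h) μ x ∂(μ.tilted h) =
      ∫ x, h x ∂(μ.tilted h) - Real.log (∫ x, Real.exp (h x) ∂μ) := by
  have hexp : Integrable (fun x => Real.exp (h x)) μ := by
    simpa using integrable_of_abs_le (μ := μ) (by fun_prop)
      (exists_abs_exp_mul_le (g := h) 1 hb)
  have := isProbabilityMeasure_tilted hexp
  have heq : llr (μ.tilted h) μ =ᵐ[μ.tilted h]
      fun x => h x - Real.log (∫ x, Real.exp (h x) ∂μ) :=
    (tilted_absolutelyContinuous μ h).ae_le (log_rnDeriv_tilted_left_self hexp)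
  have hi : Integrable h (μ.tilted h) := integrable_of_abs_le hm hb
  refine ⟨(integrable_congr heq).2 (hi.sub (integrable_const _)), ?_⟩
  rw [integral_congr_ae heq, integral_sub hi (integrable_const _)]
  simp

/-- The tilt by αg/2 is the extremal measure in the entropy variational formula: 2/α times its
entropy is ∫ g dν − (2/α) log Z, so ∫ g dν cancels against the duality bound and leaves (2/α) log Z
≤ ∫ f dμ. -/
theorem SatisfiesT2.infConvolutionInequality {M : Type*} [MetricSpace M] [MeasurableSpace M]
    [BorelSpace M] {μ : Measure M} [IsProbabilityMeasure μ] {α : ℝ} (hα : 0 < α)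
    (hT2 : SatisfiesT2 μ α) :
    InfConvolutionInequality {f | Measurable f} μ (fun x y => dist x y ^ 2) (α / 2) := by
  intro f hf g hg hfb hgb hfg
  obtain ⟨C, hC⟩ := exists_abs_exp_mul_le (α / 2) hgb
  set h : M → ℝ := fun x => α / 2 * g x with h_def
  have hm : Measurable h := by fun_prop
  have hb : ∃ C, ∀ x, |h x| ≤ C := by
    obtain ⟨C, hC⟩ := hgb
    refine ⟨|α / 2| * C, fun x => ?_⟩
    rw [h_def, abs_mul]
    gcongr
    exact hC x
  have hexp : Integrable (fun x => Real.exp (h x)) μ :=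
    integrable_of_abs_le (by fun_prop) ⟨C, hC⟩
  have hprob := isProbabilityMeasure_tilted hexp
  obtain ⟨hint, hval⟩ := integral_llr_tilted_self (μ := μ) hm hb
  have hac := tilted_absolutelyContinuous μ h
  have hkl := InformationTheory.klDiv_ne_top hac hint
  have hle := (ofReal_integral_sub_integral_le_wassersteinDist_sq hf hg hfb hgb
    hfg).trans (hT2 (μ.tilted h) hprob hkl)
  rw [← ENNReal.ofReal_toReal hkl, ← ENNReal.ofReal_mul (by positivity),
    ENNReal.ofReal_le_ofReal_iff (by positivity),
    InformationTheory.toReal_klDiv_of_measure_eq hac (by simp), hval, h_def,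
    integral_const_mul] at hle
  have hpos : 0 < ∫ x, Real.exp (h x) ∂μ := integral_exp_pos hexp
  rw [← Real.log_le_iff_le_exp hpos]
  have : 2 / α * (α / 2 * ∫ x, g x ∂(μ.tilted h) - Real.log (∫ x, Real.exp (h x) ∂μ)) =
      ∫ x, g x ∂(μ.tilted h) - 2 / α * Real.log (∫ x, Real.exp (h x) ∂μ) := by
    field_simp
  rw [this] at hle
  have h3 : 2 / α * Real.log (∫ x, Real.exp (h x) ∂μ) ≤ ∫ x, f x ∂μ := by linarith
  calc _ = α / 2 * (2 / α * Real.log (∫ x, Real.exp (h x) ∂μ)) := by field_simp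
    _ ≤ _ := by gcongr

/-! ### Tensorization -/

lemma abs_integral_le_of_abs_le {X : Type*} [MeasurableSpace X] {μ : Measure X}
    [IsProbabilityMeasure μ] {f : X → ℝ} {C : ℝ} (h : ∀ x, |f x| ≤ C) : |∫ x, f x ∂μ| ≤ C := by
  simpa using norm_integral_le_of_norm_le_const (μ := μ) (f := f) (C := C)
    (Filter.Eventually.of_forall h)

/-- Tensorization of the infimum-convolution inequality. -/
lemma InfConvolutionInequality.prod {X Y : Type*} [MetricSpace X] [MeasurableSpace X]
    [BorelSpace X] [SecondCountableTopology X] [MetricSpace Y] [MeasurableSpace Y] [BorelSpace Y]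
    [SecondCountableTopology Y] {μ : Measure X} {ν : Measure Y} [IsProbabilityMeasure μ]
    [IsProbabilityMeasure ν] {c : X → X → ℝ} {d : Y → Y → ℝ} {a : ℝ}
    (hν : InfConvolutionInequality {f | Measurable f} ν d a)
    (hμ : InfConvolutionInequality {f | Continuous f} μ c a)
    (hc0 : ∀ x y, 0 ≤ c x y) (hc : ∀ x, c x x = 0) (hcc : ∀ y, Continuous fun x => c x y) :
    InfConvolutionInequality {f | Continuous f} (ν.prod μ)
      (fun z w => d z.1 w.1 + c z.2 w.2) a := by
  rintro f (hf : Continuous f) g hg ⟨C, hC⟩ ⟨D, hD⟩ hfg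
  have hne : Nonempty X := nonempty_of_isProbabilityMeasure μ
  -- Infimum-convolution in the X variable alone: h mediates between g and f, one factor at a time.
  set h : X × Y → ℝ := fun z => ⨅ x', (f (z.2, x') + c z.1 x') with h_def
  have hbdd : ∀ z : X × Y, BddBelow (Set.range fun x' => f (z.2, x') + c z.1 x') := by
    rintro z
    refine ⟨-C, ?_⟩
    rintro _ ⟨x', rfl⟩
    have := (abs_le.1 (hC (z.2, x'))).1
    have := hc0 z.1 x'
    simp only
    linarith
  have h_le : ∀ x x' y, h (x, y) ≤ f (y, x') + c x x' := fun x x' y => ciInf_le (hbdd (x, y)) x'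
  have h_abs : ∀ z, |h z| ≤ C := by
    rintro ⟨x, y⟩
    rw [abs_le]
    constructor
    · refine le_ciInf fun x' => ?_
      have := (abs_le.1 (hC (y, x'))).1
      have := hc0 x x'
      simp only
      linarith
    · refine (h_le x x y).trans ?_
      rw [hc, add_zero]
      exact (abs_le.1 (hC _)).2
  -- An infimum of continuous functions is upper semicontinuous, hence Borel; this is why f is
  -- continuous in the product. As h(x, ·) is only known to be measurable, `hν` must cover
  -- measurable test functions.
  have h_meas : Measurable h := by
    refine UpperSemicontinuous.measurable (upperSemicontinuous_ciInf hbdd fun x' => ?_)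
    refine Continuous.upperSemicontinuous ?_
    exact (hf.comp (by fun_prop)).add ((hcc x').comp continuous_fst)
  have hH_meas : Measurable fun x => ∫ y, h (x, y) ∂ν :=
    (h_meas.stronglyMeasurable.integral_prod_right').measurable
  have hfbar : Continuous fun x' => ∫ y, f (y, x') ∂ν := by
    refine continuous_of_dominated (F := fun x' y => f (y, x')) (bound := fun _ => C) ?_ ?_ ?_ ?_
    · exact fun x' => (hf.comp (by fun_prop)).aestronglyMeasurable
    · exact fun x' => Filter.Eventually.of_forall fun y => hC _
    · exact integrable_const _
    · exact Filter.Eventually.of_forall fun y => hf.comp (by fun_prop)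
  have inner : ∀ x, ∫ y, Real.exp (a * g (y, x)) ∂ν ≤ Real.exp (a * ∫ y, h (x, y) ∂ν) := by
    intro x
    refine hν (fun y => h (x, y)) (h_meas.comp (by fun_prop)) (fun y => g (y, x))
      (hg.comp (by fun_prop)) ⟨C, fun y => h_abs _⟩ ⟨D, fun y => hD _⟩ fun y y' => ?_
    rw [← sub_le_iff_le_add]
    refine le_ciInf fun x' => ?_
    have := hfg (y, x) (y', x')
    simp only at this ⊢
    linarith
  have outer : ∫ x, Real.exp (a * ∫ y, h (x, y) ∂ν) ∂μ ≤
      Real.exp (a * ∫ x, ∫ y, f (y, x) ∂ν ∂μ) := by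
    refine hμ (fun x => ∫ y, f (y, x) ∂ν) hfbar (fun x => ∫ y, h (x, y) ∂ν) hH_meas
      ⟨C, fun x => abs_integral_le_of_abs_le fun y => hC _⟩
      ⟨C, fun x => abs_integral_le_of_abs_le fun y => h_abs _⟩ fun x x' => ?_
    have i1 : Integrable (fun y => f (y, x')) ν :=
      integrable_of_abs_le (hf.comp (by fun_prop)).measurable ⟨C, fun y => hC _⟩
    calc ∫ y, h (x, y) ∂ν ≤ ∫ y, (f (y, x') + c x x') ∂ν :=
          integral_mono (integrable_of_abs_le (h_meas.comp (by fun_prop)) ⟨C, fun y => h_abs _⟩)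
            (i1.add (integrable_const _)) fun y => h_le x x' y
      _ = _ := by rw [integral_add i1 (integrable_const _)]; simp
  have ie : Integrable (fun z => Real.exp (a * g z)) (ν.prod μ) :=
    integrable_of_abs_le (by fun_prop) (exists_abs_exp_mul_le a ⟨D, hD⟩)
  rw [integral_prod_symm _ ie,
    integral_prod_symm _ (integrable_of_abs_le hf.measurable ⟨C, hC⟩)]
  refine le_trans (integral_mono ie.integral_prod_right ?_ inner) outer
  exact integrable_of_abs_le (by fun_prop)
    (exists_abs_exp_mul_le a ⟨C, fun x => abs_integral_le_of_abs_le fun y => h_abs _⟩)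

lemma InfConvolutionInequality.pi {M : Type*} [MetricSpace M] [MeasurableSpace M] [BorelSpace M]
    [SecondCountableTopology M] {μ : Measure M} [IsProbabilityMeasure μ] {a : ℝ} (ha : 0 ≤ a)
    (h : InfConvolutionInequality {f | Measurable f} μ (fun x y => dist x y ^ 2) a) (n : ℕ) :
    InfConvolutionInequality {f | Continuous f} (Measure.pi fun _ : Fin n => μ)
      (fun x y => ∑ i, dist (x i) (y i) ^ 2) a := by
  induction n with
  | zero =>
    rintro f - g - - - hfg
    have hu : ∀ x : Fin 0 → M, x = default := fun x => Subsingleton.elim _ _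
    have h0 := hfg default default
    simp only [Finset.univ_eq_empty, Finset.sum_empty, add_zero] at h0
    rw [integral_congr_ae (g := fun _ => Real.exp (a * g default))
      (Filter.Eventually.of_forall fun x => by rw [hu x]),
      integral_congr_ae (f := f) (g := fun _ => f default)
      (Filter.Eventually.of_forall fun x => by rw [hu x])]
    simp only [integral_const, probReal_univ, smul_eq_mul, one_mul, Real.exp_le_exp]
    gcongr
  | succ n ih =>
    have hprod := h.prod ih (fun x y => by positivity) (by simp) (fun y => by fun_prop)
    rintro f (hf : Continuous f) g hg ⟨C, hC⟩ ⟨D, hD⟩ hfg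
    have hmp := (measurePreserving_piFinSuccAbove (fun _ : Fin (n + 1) => μ) 0).symm
    have hcons : ∀ z, (MeasurableEquiv.piFinSuccAbove (fun _ : Fin (n + 1) => M) 0).symm z =
      Fin.cons z.1 z.2 := fun z => by simp [MeasurableEquiv.piFinSuccAbove, Fin.consEquiv]
    have hcont : Continuous
        (MeasurableEquiv.piFinSuccAbove (fun _ : Fin (n + 1) => M) 0).symm := by
      simp_rw [funext hcons]
      fun_prop
    rw [← hmp.integral_comp (MeasurableEquiv.measurableEmbedding _),
      ← hmp.integral_comp (MeasurableEquiv.measurableEmbedding _)]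
    refine hprod _ (hf.comp hcont) _ (hg.comp (MeasurableEquiv.measurable _))
      ⟨C, fun _ => hC _⟩ ⟨D, fun _ => hD _⟩ fun z w => ?_
    refine (hfg _ ((MeasurableEquiv.piFinSuccAbove (fun _ => M) 0).symm w)).trans_eq ?_
    simp only [hcons, Fin.sum_univ_succ, Fin.cons_zero, Fin.cons_succ, Function.comp]

/-! ### Gaussian moment generating functions -/

/-- Functions that are Lipschitz for the `ℓ²` product distance are sub-Gaussian under a product of
measures satisfying the infimum-convolution inequality. -/
lemma InfConvolutionInequality.integral_exp_le {M : Type*} [MetricSpace M] [MeasurableSpace M]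
    [BorelSpace M] [SecondCountableTopology M] {μ : Measure M} [IsProbabilityMeasure μ] {α : ℝ}
    (hα : 0 < α) (h : InfConvolutionInequality {f | Measurable f} μ (fun x y => dist x y ^ 2)
      (α / 2)) {n : ℕ} {F : (Fin n → M) → ℝ} (hF : Continuous F) (hb : ∃ C, ∀ x, |F x| ≤ C)
    {L : ℝ} (hL : 0 ≤ L)
    (hLip : ∀ x y, |F x - F y| ≤ √(L * ∑ i, dist (x i) (y i) ^ 2)) (t : ℝ) :
    ∫ x, Real.exp (t * F x) ∂(Measure.pi fun _ : Fin n => μ) ≤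
      Real.exp (t * ∫ x, F x ∂(Measure.pi fun _ : Fin n => μ) + L / α * t ^ 2 / 2) := by
  obtain ⟨C, hC⟩ := hb
  -- Rescaled so that (α/2)s = t. Since |s|√(LS) ≤ s²L/4 + S, the pair sF, sF − s²L/4 is admissible,
  -- and (α/2)s²L/4 = Lt²/(2α).
  set s := 2 / α * t with hs
  have hts : t = α / 2 * s := by rw [hs]; field_simp
  have key := h.pi (by positivity) n (fun x => s * F x) (by fun_prop : Continuous _)
    (fun x => s * F x - s ^ 2 * L / 4) (by fun_prop)
    ⟨|s| * C, fun x => by rw [abs_mul]; gcongr; exact hC x⟩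
    ⟨|s| * C + |s ^ 2 * L / 4|, fun x => (abs_sub _ _).trans (by
      rw [abs_mul]; gcongr; exact hC x)⟩ (fun x y => by
      set S := ∑ i, dist (x i) (y i) ^ 2 with hS
      have hS0 : 0 ≤ S := by positivity
      have h1 : s * F x - s * F y ≤ |s| * √(L * S) := by
        rw [← mul_sub]
        refine (le_abs_self _).trans ?_
        rw [abs_mul]
        gcongr
        exact hLip x y
      have h2 : √(L * S) = √L * √S := Real.sqrt_mul hL S
      have h3 := Real.sq_sqrt hS0
      have h4 := Real.sq_sqrt hL
      have h5 := sq_nonneg (|s| * √L / 2 - √S)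
      have h6 := sq_abs s
      have h7 : (|s| * √L) ^ 2 = s ^ 2 * L := by rw [mul_pow, h6, h4]
      rw [h2] at h1
      nlinarith)
  have e1 : ∀ x, Real.exp (α / 2 * (s * F x - s ^ 2 * L / 4)) =
      Real.exp (-(L / α * t ^ 2 / 2)) * Real.exp (t * F x) := by
    intro x
    rw [← Real.exp_add]
    congr 1
    rw [hts]
    field_simp
    ring
  simp_rw [e1] at key
  rw [integral_const_mul, integral_const_mul, ← mul_assoc, ← hts] at key
  rw [Real.exp_add, mul_comm]
  calc _ = Real.exp (L / α * t ^ 2 / 2) * (Real.exp (-(L / α * t ^ 2 / 2)) *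
      ∫ x, Real.exp (t * F x) ∂(Measure.pi fun _ : Fin n => μ)) := by
        rw [← mul_assoc, ← Real.exp_add]; simp
    _ ≤ _ := by gcongr

/-! ### Dependence of W_p on the atoms -/

open ProbabilityTheory in
lemma map_compProd_comap {ι X Y : Type*} [MeasurableSpace ι] [MeasurableSpace X]
    [MeasurableSpace Y] (m : Measure ι) [IsFiniteMeasure m] (K : Kernel X Y) [IsMarkovKernel K]
    {u : ι → X} (hu : Measurable u) :
    (m ⊗ₘ K.comap u hu).map (Prod.map u id) = m.map u ⊗ₘ K := by
  ext s hs
  have hu' : Measurable (Prod.map u (id : Y → Y)) := hu.prodMap measurable_id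
  rw [Measure.map_apply hu' hs, Measure.compProd_apply (hu' hs), Measure.compProd_apply hs,
    lintegral_map (Kernel.measurable_kernel_prodMk_left hs) hu]
  rfl

open ProbabilityTheory in
/-- A measure on `X × Y` whose first marginal is an image of `m` lifts to a measure with first
marginal `m`. -/
lemma exists_lift_of_map_fst_eq {ι X Y : Type*} [MeasurableSpace ι] [MeasurableSpace X]
    [MeasurableSpace Y] [StandardBorelSpace Y] [Nonempty Y] (m : Measure ι) [IsFiniteMeasure m]
    {u : ι → X} (hu : Measurable u) (π : Measure (X × Y)) [IsFiniteMeasure π]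
    (hπ : π.map Prod.fst = m.map u) :
    ∃ ρ : Measure (ι × Y), ρ.map Prod.fst = m ∧ ρ.map (Prod.map u id) = π := by
  -- Disintegrate π over its first marginal and let i ∈ ι use the conditional law at u(i).
  refine ⟨m ⊗ₘ π.condKernel.comap u hu, ?_, ?_⟩
  · exact Measure.fst_compProd m _
  · rw [map_compProd_comap, ← hπ]
    exact π.disintegrate π.condKernel

lemma empiricalDist_eq_map {M : Type*} [MeasurableSpace M] {N : ℕ} (ξ : Fin N → M) :
    empiricalDist ξ = (empiricalDist (id : Fin N → Fin N)).map ξ := by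
  rw [empiricalDist, empiricalDist, Measure.map_smul, Measure.map_finset_sum (by fun_prop)]
  simp [Measure.map_dirac' (measurable_of_finite ξ)]

lemma lintegral_empiricalDist {M : Type*} [MeasurableSpace M] {N : ℕ} (ξ : Fin N → M)
    {f : M → ℝ≥0∞} (hf : Measurable f) :
    ∫⁻ x, f x ∂(empiricalDist ξ) = (N : ℝ≥0∞)⁻¹ * ∑ j, f (ξ j) := by
  simp [empiricalDist, lintegral_dirac' _ hf]

lemma isProbabilityMeasure_empiricalDist {M : Type*} [MeasurableSpace M] {N : ℕ} (hN : 1 ≤ N)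
    (ξ : Fin N → M) : IsProbabilityMeasure (empiricalDist ξ) := by
  refine ⟨?_⟩
  have : (N : ℝ≥0∞) ≠ 0 := by simp; omega
  simp [empiricalDist, ENNReal.inv_mul_cancel this]

lemma wassersteinDist_le_of_mem {M : Type*} [MetricSpace M] [MeasurableSpace M] {p : ℝ}
    (hp : 0 ≤ p) {μ ν : Measure M} {π : Measure (M × M)} (hπ : π ∈ TransportPlans μ ν) :
    wassersteinDist p μ ν ≤ (∫⁻ z, edist z.1 z.2 ^ p ∂π) ^ (1 / p) :=
  ENNReal.rpow_le_rpow (iInf₂_le π hπ) (by positivity)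

lemma le_wassersteinDist {M : Type*} [MetricSpace M] [MeasurableSpace M] {p : ℝ}
    (hp : 0 < p) {μ ν : Measure M} {r : ℝ≥0∞}
    (h : ∀ π ∈ TransportPlans μ ν, r ≤ (∫⁻ z, edist z.1 z.2 ^ p ∂π) ^ (1 / p)) :
    r ≤ wassersteinDist p μ ν := by
  rw [wassersteinDist, one_div, ENNReal.le_rpow_inv_iff hp]
  refine le_iInf₂ fun π hπ => ?_
  have := h π hπ
  rwa [one_div, ENNReal.le_rpow_inv_iff hp] at this

/-- Moving the atoms of an empirical measure changes its Wasserstein distance to `μ` by at most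
the `ℓ^p` mean of the displacements. -/
theorem wassersteinDist_empiricalDist_le {M : Type*} [MetricSpace M] [CompleteSpace M]
    [SecondCountableTopology M] [MeasurableSpace M] [BorelSpace M]
    {μ : Measure M} [IsProbabilityMeasure μ] {N : ℕ} (hN : 1 ≤ N) {p : ℝ} (hp : 1 ≤ p)
    (ξ η : Fin N → M) :
    wassersteinDist p (empiricalDist η) μ ≤
      ((N : ℝ≥0∞)⁻¹ * ∑ j, edist (η j) (ξ j) ^ p) ^ (1 / p) +
        wassersteinDist p (empiricalDist ξ) μ := by
  have hne : Nonempty M := nonempty_of_isProbabilityMeasure μ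
  have hp0 : 0 < p := by linarith
  have := isProbabilityMeasure_empiricalDist hN (id : Fin N → Fin N)
  rw [← tsub_le_iff_left]
  refine le_wassersteinDist hp0 fun π hπ => ?_
  rw [tsub_le_iff_left]
  have hfin : IsFiniteMeasure π := ⟨by
    rw [← Set.preimage_univ (f := Prod.snd), ← Measure.map_apply measurable_snd .univ, hπ.2]
    simp⟩
  -- The lifted plan records the index its mass comes from, even when atoms coincide, so each share
  -- can be rerouted from ξ j to η j. Completeness enters here, through disintegration on a standard
  -- Borel space.
  obtain ⟨ρ, hρ1, hρ2⟩ := exists_lift_of_map_fst_eq (empiricalDist (id : Fin N → Fin N))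
    (measurable_of_finite ξ) π (by rw [hπ.1, empiricalDist_eq_map])
  have hξ : Measurable (Prod.map ξ (id : M → M)) := (measurable_of_finite ξ).prodMap measurable_id
  have hη : Measurable (Prod.map η (id : M → M)) := (measurable_of_finite η).prodMap measurable_id
  have hplan : ρ.map (Prod.map η id) ∈ TransportPlans (empiricalDist η) μ := by
    constructor
    · rw [Measure.map_map measurable_fst hη, empiricalDist_eq_map η, ← hρ1,
        Measure.map_map (measurable_of_finite η) measurable_fst]
      rfl
    · rw [← hπ.2, ← hρ2, Measure.map_map measurable_snd hη, Measure.map_map measurable_snd hξ]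
      rfl
  have hcost : Measurable fun z : M × M => edist z.1 z.2 ^ p := by fun_prop
  refine (wassersteinDist_le_of_mem hp0.le hplan).trans ?_
  rw [lintegral_map hcost hη, ← hρ2, lintegral_map hcost hξ]
  have hm1 : Measurable fun z : Fin N × M => edist (η z.1) (ξ z.1) :=
    (measurable_of_finite fun j => edist (η j) (ξ j)).comp measurable_fst
  have hm2 : Measurable fun z : Fin N × M => edist (ξ z.1) z.2 := by
    have : Measurable fun z : M × M => edist z.1 z.2 := by fun_prop
    exact this.comp hξ
  have hfst : (N : ℝ≥0∞)⁻¹ * ∑ j, edist (η j) (ξ j) ^ p =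
      ∫⁻ z, edist (η z.1) (ξ z.1) ^ p ∂ρ := by
    have hm : Measurable fun j => edist (η j) (ξ j) ^ p := measurable_of_finite _
    rw [← lintegral_map hm measurable_fst, hρ1, lintegral_empiricalDist _ hm]
    rfl
  rw [hfst]
  -- Minkowski's inequality in L^p(ρ).
  refine le_trans ?_ (ENNReal.lintegral_Lp_add_le hm1.aemeasurable hm2.aemeasurable hp)
  refine ENNReal.rpow_le_rpow (lintegral_mono fun z => ?_) (by positivity)
  exact ENNReal.rpow_le_rpow (edist_triangle _ _ _) hp0.le

/-- Cauchy–Schwarz for p = 1, equality for p = 2. -/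
lemma mean_rpow_le_sqrt {N : ℕ} (hN : 1 ≤ N) {p : ℝ} (hp : p = 1 ∨ p = 2) (a : Fin N → ℝ)
    (ha : ∀ j, 0 ≤ a j) :
    ((N : ℝ≥0∞)⁻¹ * ∑ j, ENNReal.ofReal (a j) ^ p) ^ (1 / p) ≤
      ENNReal.ofReal √((N : ℝ)⁻¹ * ∑ j, a j ^ 2) := by
  have hN0 : (0 : ℝ) < N := by exact_mod_cast hN
  have e : (N : ℝ≥0∞)⁻¹ = ENNReal.ofReal (N : ℝ)⁻¹ := by
    rw [ENNReal.ofReal_inv_of_pos hN0, ENNReal.ofReal_natCast]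
  have hp0 : 0 ≤ p := by rcases hp with rfl | rfl <;> norm_num
  simp_rw [fun j => ENNReal.ofReal_rpow_of_nonneg (ha j) hp0]
  have hnn : ∀ j, 0 ≤ a j ^ p := fun j => Real.rpow_nonneg (ha j) p
  rw [e, ← ENNReal.ofReal_sum_of_nonneg fun j _ => hnn j,
    ← ENNReal.ofReal_mul (by positivity),
    ENNReal.ofReal_rpow_of_nonneg (mul_nonneg (by positivity) (Finset.sum_nonneg fun j _ => hnn j))
      (by positivity)]
  refine ENNReal.ofReal_le_ofReal ?_
  rcases hp with rfl | rfl
  · simp only [Real.rpow_one, div_one]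
    refine Real.le_sqrt_of_sq_le ?_
    have := sq_sum_le_card_mul_sum_sq (s := Finset.univ) (f := a)
    rw [Finset.card_univ, Fintype.card_fin] at this
    rw [mul_pow]
    calc _ ≤ (N : ℝ)⁻¹ ^ 2 * (N * ∑ j, a j ^ 2) := by gcongr
      _ = _ := by field_simp
  · rw [Real.sqrt_eq_rpow]
    simp

/-! ### Finite second moment -/

lemma wassersteinDist_le_lintegral_prod {M : Type*} [MetricSpace M]
    [SecondCountableTopology M] [MeasurableSpace M] [BorelSpace M]
    {μ ν : Measure M} [IsProbabilityMeasure μ] [IsProbabilityMeasure ν] {p : ℝ} (hp : 0 ≤ p) :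
    wassersteinDist p ν μ ≤ (∫⁻ x, ∫⁻ y, edist x y ^ p ∂μ ∂ν) ^ (1 / p) := by
  refine (wassersteinDist_le_of_mem hp (π := ν.prod μ) ⟨?_, ?_⟩).trans_eq ?_
  · simp
  · simp
  · rw [lintegral_prod _ (by fun_prop)]

lemma edist_sq_le {M : Type*} [MetricSpace M] (x y z : M) :
    edist x z ^ (2 : ℝ) ≤ 2 * (edist x y ^ (2 : ℝ) + edist y z ^ (2 : ℝ)) := by
  refine (ENNReal.rpow_le_rpow (edist_triangle x y z) zero_le_two).trans ?_
  have := ENNReal.rpow_add_le_mul_rpow_add_rpow (edist x y) (edist y z) (p := 2) one_le_two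
  norm_num at this ⊢
  exact this

/-- The log-density is constant on s, namely −log μ(s). -/
lemma klDiv_cond_ne_top {X : Type*} [MeasurableSpace X] {μ : Measure X} [IsProbabilityMeasure μ]
    {s : Set X} (hs : MeasurableSet s) (h0 : μ s ≠ 0) :
    InformationTheory.klDiv (ProbabilityTheory.cond μ s) μ ≠ ∞ := by
  refine InformationTheory.klDiv_ne_top ProbabilityTheory.cond_absolutelyContinuous ?_
  have := ProbabilityTheory.cond_isProbabilityMeasure h0
  have hr : (ProbabilityTheory.cond μ s).rnDeriv μ =ᵐ[μ]
      s.indicator (fun _ => (μ s)⁻¹) := by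
    have : ProbabilityTheory.cond μ s = μ.withDensity (s.indicator (fun _ => (μ s)⁻¹)) := by
      rw [withDensity_indicator hs, withDensity_const]
      rfl
    rw [this]
    exact Measure.rnDeriv_withDensity _ (measurable_const.indicator hs)
  have hr' := (ProbabilityTheory.cond_absolutelyContinuous (s := s)).ae_le hr
  have hms : ∀ᵐ x ∂(ProbabilityTheory.cond μ s), x ∈ s := ProbabilityTheory.ae_cond_mem hs
  have heq : llr (ProbabilityTheory.cond μ s) μ =ᵐ[ProbabilityTheory.cond μ s]
      fun _ => Real.log ((μ s)⁻¹).toReal := by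
    filter_upwards [hr', hms] with x h1 h2
    rw [llr, h1, Set.indicator_of_mem h2]
  exact (integrable_congr heq).2 (integrable_const _)

/-- Conditioning μ on a ball of positive mass gives finite entropy, so by T_2 some plan to μ has
finite quadratic cost. Its first coordinate stays in the ball, so the second has a finite second
moment. -/
lemma SatisfiesT2.lintegral_edist_sq_ne_top {M : Type*} [MetricSpace M] [MeasurableSpace M]
    [SecondCountableTopology M] [BorelSpace M] {μ : Measure M} [IsProbabilityMeasure μ] {α : ℝ}
    (hT2 : SatisfiesT2 μ α) (x₀ : M) : ∫⁻ y, edist x₀ y ^ (2 : ℝ) ∂μ ≠ ∞ := by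
  obtain ⟨n, hn⟩ : ∃ n : ℕ, μ (Metric.ball x₀ n) ≠ 0 := by
    by_contra! h
    have := measure_iUnion_null h
    rw [Metric.iUnion_ball_nat] at this
    simp at this
  have hs : MeasurableSet (Metric.ball x₀ (n : ℝ)) := Metric.isOpen_ball.measurableSet
  set ν := ProbabilityTheory.cond μ (Metric.ball x₀ n) with hν
  have hprob : IsProbabilityMeasure ν := ProbabilityTheory.cond_isProbabilityMeasure hn
  have hfin : wassersteinDist 2 ν μ ≠ ∞ := by
    intro htop
    have := hT2 ν hprob (klDiv_cond_ne_top hs hn)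
    rw [htop] at this
    simp only [ne_eq, OfNat.ofNat_ne_zero, not_false_eq_true, ENNReal.top_pow, top_le_iff] at this
    exact ENNReal.mul_ne_top ENNReal.ofReal_ne_top (klDiv_cond_ne_top hs hn) this
  obtain ⟨π, hπ, hπfin⟩ : ∃ π ∈ TransportPlans ν μ, ∫⁻ z, edist z.1 z.2 ^ (2 : ℝ) ∂π ≠ ∞ := by
    by_contra! h
    refine hfin (top_le_iff.1 (le_wassersteinDist two_pos fun π hπ => ?_))
    rw [h π hπ]
    simp
  have hball : ∀ᵐ z ∂π, z.1 ∈ Metric.ball x₀ (n : ℝ) := by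
    have : ∀ᵐ x ∂ν, x ∈ Metric.ball x₀ (n : ℝ) := ProbabilityTheory.ae_cond_mem hs
    rw [← hπ.1] at this
    exact ae_of_ae_map measurable_fst.aemeasurable this
  have hπprob : π Set.univ = 1 := by
    rw [← Set.preimage_univ (f := Prod.fst), ← Measure.map_apply measurable_fst .univ, hπ.1]
    simp
  have hm : Measurable fun z : M × M => edist z.1 z.2 ^ (2 : ℝ) := by fun_prop
  refine ne_top_of_le_ne_top (b := 2 * ((n : ℝ≥0∞) ^ (2 : ℝ) +
    ∫⁻ z, edist z.1 z.2 ^ (2 : ℝ) ∂π)) ?_ ?_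
  · have : (n : ℝ≥0∞) ^ (2 : ℝ) ≠ ∞ := by simp
    exact ENNReal.mul_ne_top (by simp) (ENNReal.add_ne_top.2 ⟨this, hπfin⟩)
  · rw [← hπ.2, lintegral_map (by fun_prop) measurable_snd]
    calc ∫⁻ z, edist x₀ z.2 ^ (2 : ℝ) ∂π
        ≤ ∫⁻ z, 2 * ((n : ℝ≥0∞) ^ (2 : ℝ) + edist z.1 z.2 ^ (2 : ℝ)) ∂π := by
          refine lintegral_mono_ae ?_
          filter_upwards [hball] with z hz
          refine (edist_sq_le x₀ z.1 z.2).trans ?_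
          gcongr
          rw [Metric.mem_ball, dist_comm] at hz
          rw [edist_dist, ← ENNReal.ofReal_natCast]
          exact ENNReal.ofReal_le_ofReal hz.le
      _ = _ := by
          rw [lintegral_const_mul _ (by fun_prop), lintegral_add_left measurable_const]
          simp [hπprob]

/-! ### Concentration for Lipschitz functions -/

lemma continuous_of_abs_sub_le_sqrt {M : Type*} [MetricSpace M] {n : ℕ} {F : (Fin n → M) → ℝ}
    {L : ℝ} (hLip : ∀ x y, |F x - F y| ≤ √(L * ∑ i, dist (x i) (y i) ^ 2)) : Continuous F := by
  refine continuous_iff_continuousAt.2 fun y => ?_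
  refine tendsto_iff_dist_tendsto_zero.2 (squeeze_zero (fun _ => dist_nonneg)
    (fun x => hLip x y) ?_)
  have : Continuous fun x : Fin n → M => √(L * ∑ i, dist (x i) (y i) ^ 2) := by fun_prop
  simpa using this.tendsto y

lemma InfConvolutionInequality.measureReal_ge_le_of_bounded {M : Type*} [MetricSpace M]
    [MeasurableSpace M]
    [BorelSpace M] [SecondCountableTopology M] {μ : Measure M} [IsProbabilityMeasure μ] {α : ℝ}
    (hα : 0 < α) (h : InfConvolutionInequality {f | Measurable f} μ (fun x y => dist x y ^ 2)
      (α / 2)) {n : ℕ} {F : (Fin n → M) → ℝ} (hb : ∃ C, ∀ x, |F x| ≤ C)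
    {L : ℝ} (hL : 0 ≤ L)
    (hLip : ∀ x y, |F x - F y| ≤ √(L * ∑ i, dist (x i) (y i) ^ 2)) {ε : ℝ} (hε : 0 ≤ ε) :
    (Measure.pi fun _ : Fin n => μ).real
      {x | ε ≤ F x - ∫ y, F y ∂(Measure.pi fun _ : Fin n => μ)} ≤
      Real.exp (-ε ^ 2 / (2 * (L / α))) := by
  set P := Measure.pi fun _ : Fin n => μ
  have hF := continuous_of_abs_sub_le_sqrt hLip
  have hsub : ProbabilityTheory.HasSubgaussianMGF (fun x => F x - ∫ y, F y ∂P)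
      ⟨L / α, by positivity⟩ P := by
    have e : ∀ t x, Real.exp (t * (F x - ∫ y, F y ∂P)) =
        Real.exp (-(t * ∫ y, F y ∂P)) * Real.exp (t * F x) := fun t x => by
      rw [← Real.exp_add]; ring_nf
    refine ⟨fun t => ?_, fun t => ?_⟩
    · simp_rw [e t]
      exact (integrable_of_abs_le (by fun_prop) (exists_abs_exp_mul_le t hb)).const_mul _
    · rw [ProbabilityTheory.mgf]
      simp_rw [e t]
      rw [integral_const_mul]
      calc _ ≤ Real.exp (-(t * ∫ y, F y ∂P)) *
            Real.exp (t * ∫ x, F x ∂P + L / α * t ^ 2 / 2) := by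
            gcongr
            exact h.integral_exp_le hα hF hb hL hLip t
        _ = _ := by rw [← Real.exp_add, neg_add_cancel_left]; rfl
  exact hsub.measure_ge_le hε

/-- Two-sided Gaussian concentration for integrable nonnegative functions that are Lipschitz for
the `ℓ²` product distance. -/
theorem InfConvolutionInequality.measure_abs_sub_integral_gt_le {M : Type*} [MetricSpace M]
    [MeasurableSpace M] [BorelSpace M] [SecondCountableTopology M] {μ : Measure M}
    [IsProbabilityMeasure μ] {α : ℝ}
    (hα : 0 < α) (h : InfConvolutionInequality {f | Measurable f} μ (fun x y => dist x y ^ 2)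
      (α / 2)) {n : ℕ} {F : (Fin n → M) → ℝ} (hF0 : ∀ x, 0 ≤ F x)
    (hint : Integrable F (Measure.pi fun _ : Fin n => μ)) {L : ℝ} (hL : 0 ≤ L)
    (hLip : ∀ x y, |F x - F y| ≤ √(L * ∑ i, dist (x i) (y i) ^ 2)) {ε : ℝ} (hε : 0 < ε) :
    (Measure.pi fun _ : Fin n => μ)
      {x | ε < |F x - ∫ y, F y ∂(Measure.pi fun _ : Fin n => μ)|} ≤
      ENNReal.ofReal (2 * Real.exp (-ε ^ 2 / (2 * (L / α)))) := by
  set P := Measure.pi fun _ : Fin n => μ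
  set E := ∫ y, F y ∂P with hE
  have hF := continuous_of_abs_sub_le_sqrt hLip
  let G : ℕ → (Fin n → M) → ℝ := fun k x => min (F x) k
  have hGF : ∀ k x, G k x ≤ F x := fun k x => min_le_left _ _
  have hG0 : ∀ k x, 0 ≤ G k x := fun k x => le_min (hF0 x) (Nat.cast_nonneg k)
  have hGb : ∀ k, ∃ C, ∀ x, |G k x| ≤ C := fun k => ⟨k, fun x => by
    rw [abs_of_nonneg (hG0 k x)]; exact min_le_right _ _⟩
  have hGc : ∀ k, Continuous (G k) := fun k => hF.min continuous_const
  have hGi : ∀ k, Integrable (G k) P := fun k => integrable_of_abs_le (hGc k).measurable (hGb k)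
  have hGLip : ∀ k x y, |G k x - G k y| ≤ √(L * ∑ i, dist (x i) (y i) ^ 2) := fun k x y => by
    refine le_trans ?_ (hLip x y)
    simpa using abs_min_sub_min_le_max (F x) k (F y) k
  have hGE : ∀ k, ∫ y, G k y ∂P ≤ E := fun k => integral_mono (hGi k) hint (hGF k)
  have upper : P.real {x | ε < F x - E} ≤ Real.exp (-ε ^ 2 / (2 * (L / α))) := by
    -- Truncating above the level ε + E keeps the upper-tail event and only lowers the mean.
    obtain ⟨k, hk⟩ := exists_nat_ge (ε + E)
    refine le_trans (measureReal_mono fun x hx => ?_)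
      (h.measureReal_ge_le_of_bounded hα (hGb k) hL (hGLip k) hε.le)
    simp only [Set.mem_ofPred_eq] at hx ⊢
    have h1 : ε + E ≤ G k x := le_min (by linarith) hk
    have := hGE k
    linarith
  have lower : P.real {x | ε < E - F x} ≤ Real.exp (-ε ^ 2 / (2 * (L / α))) := by
    have hlim : Filter.Tendsto (fun k => ∫ y, G k y ∂P) Filter.atTop (nhds E) := by
      refine tendsto_integral_of_dominated_convergence F (fun k => (hGi k).aestronglyMeasurable)
        hint (fun k => Filter.Eventually.of_forall fun x => ?_)
        (Filter.Eventually.of_forall fun x => ?_)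
      · rw [Real.norm_of_nonneg (hG0 k x)]
        exact hGF k x
      · obtain ⟨m, hm⟩ := exists_nat_ge (F x)
        refine tendsto_const_nhds.congr' ?_
        filter_upwards [Filter.eventually_ge_atTop m] with k hk
        exact (min_eq_left (hm.trans (by exact_mod_cast hk))).symm
    -- For the lower tail, truncation costs the deficit E − ∫ G k in the deviation; it vanishes as k
    -- → ∞.
    have hlim2 : Filter.Tendsto (fun k => ε - (E - ∫ y, G k y ∂P)) Filter.atTop (nhds ε) := by
      simpa using (tendsto_const_nhds (x := ε)).sub ((tendsto_const_nhds (x := E)).sub hlim)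
    have hlim3 : Filter.Tendsto (fun k => Real.exp (-(ε - (E - ∫ y, G k y ∂P)) ^ 2 /
        (2 * (L / α)))) Filter.atTop (nhds (Real.exp (-ε ^ 2 / (2 * (L / α))))) :=
      (Real.continuous_exp.tendsto _).comp ((hlim2.pow 2).neg.div_const _)
    refine ge_of_tendsto hlim3 ?_
    filter_upwards [hlim2.eventually (lt_mem_nhds hε)] with k hk
    refine le_trans (measureReal_mono fun x hx => ?_)
      (h.measureReal_ge_le_of_bounded hα (F := fun x => -G k x) (by simpa using hGb k) hL
        (fun x y => ?_) hk.le)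
    · simp only [Set.mem_ofPred_eq, integral_neg] at hx ⊢
      have := hGF k x
      linarith
    · rw [neg_sub_neg, abs_sub_comm]
      exact hGLip k x y
  have hsub : {x | ε < |F x - E|} ⊆ {x | ε < F x - E} ∪ {x | ε < E - F x} := by
    intro x (hx : ε < |F x - E|)
    rcases lt_abs.1 hx with h | h
    · exact Or.inl h
    · exact Or.inr (by simpa using h)
  rw [← ofReal_measureReal]
  refine ENNReal.ofReal_le_ofReal ?_
  calc _ ≤ P.real ({x | ε < F x - E} ∪ {x | ε < E - F x}) := measureReal_mono hsub
    _ ≤ _ := measureReal_union_le _ _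
    _ ≤ _ := by linarith

/-! ### Application to empirical distributions -/

lemma SatisfiesT2.wassersteinDist_empiricalDist_ne_top {M : Type*} [MetricSpace M]
    [SecondCountableTopology M] [MeasurableSpace M] [BorelSpace M] {μ : Measure M}
    [IsProbabilityMeasure μ] {α : ℝ} (hT2 : SatisfiesT2 μ α) {N : ℕ} (hN : 1 ≤ N) {p : ℝ}
    (hp : p = 1 ∨ p = 2) (ξ : Fin N → M) : wassersteinDist p (empiricalDist ξ) μ ≠ ∞ := by
  have hp0 : 0 ≤ p := by rcases hp with rfl | rfl <;> norm_num
  have := isProbabilityMeasure_empiricalDist hN ξ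
  refine ne_top_of_le_ne_top ?_ (wassersteinDist_le_lintegral_prod hp0)
  have hm : Measurable fun x => ∫⁻ y, edist x y ^ p ∂μ :=
    Measurable.lintegral_prod_right' (f := fun z : M × M => edist z.1 z.2 ^ p) (by fun_prop)
  refine ENNReal.rpow_ne_top_of_nonneg (by positivity) ?_
  rw [lintegral_empiricalDist ξ hm]
  refine ENNReal.mul_ne_top (by simp; omega) (ENNReal.sum_ne_top.2 fun j _ => ?_)
  rcases hp with rfl | rfl
  · refine ne_top_of_le_ne_top (b := ∫⁻ y, (1 + edist (ξ j) y ^ (2 : ℝ)) ∂μ) ?_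
      (lintegral_mono fun y => ?_)
    · rw [lintegral_add_left measurable_const]
      simpa using hT2.lintegral_edist_sq_ne_top (ξ j)
    · rw [ENNReal.rpow_one]
      rcases le_total (edist (ξ j) y) 1 with h | h
      · exact h.trans le_self_add
      · refine le_trans ?_ le_add_self
        simpa using ENNReal.rpow_le_rpow_of_exponent_le h one_le_two
  · exact hT2.lintegral_edist_sq_ne_top (ξ j)

lemma SatisfiesT2.abs_wassersteinDist_empiricalDist_sub_le {M : Type*} [MetricSpace M]
    [CompleteSpace M] [SecondCountableTopology M] [MeasurableSpace M] [BorelSpace M]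
    {μ : Measure M} [IsProbabilityMeasure μ] {α : ℝ} (hT2 : SatisfiesT2 μ α) {N : ℕ} (hN : 1 ≤ N)
    {p : ℝ} (hp : p = 1 ∨ p = 2) (ξ η : Fin N → M) :
    |(wassersteinDist p (empiricalDist ξ) μ).toReal -
      (wassersteinDist p (empiricalDist η) μ).toReal| ≤
      √((N : ℝ)⁻¹ * ∑ j, dist (ξ j) (η j) ^ 2) := by
  have hp1 : 1 ≤ p := by rcases hp with rfl | rfl <;> norm_num
  have key : ∀ ξ η : Fin N → M, (wassersteinDist p (empiricalDist ξ) μ).toReal ≤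
      √((N : ℝ)⁻¹ * ∑ j, dist (ξ j) (η j) ^ 2) +
        (wassersteinDist p (empiricalDist η) μ).toReal := fun ξ η => by
    have h2 := hT2.wassersteinDist_empiricalDist_ne_top hN hp η
    have h1 := (wassersteinDist_empiricalDist_le (μ := μ) hN hp1 η ξ).trans
      (add_le_add_left (by
        simp_rw [edist_dist]
        exact mean_rpow_le_sqrt hN hp (fun j => dist (ξ j) (η j)) fun _ => dist_nonneg) _)
    have := ENNReal.toReal_mono (ENNReal.add_ne_top.2 ⟨ENNReal.ofReal_ne_top, h2⟩) h1
    rwa [ENNReal.toReal_add ENNReal.ofReal_ne_top h2,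
      ENNReal.toReal_ofReal (Real.sqrt_nonneg _)] at this
  rw [abs_sub_le_iff]
  have h1 := key ξ η
  have h2 := key η ξ
  simp_rw [dist_comm (η _) (ξ _)] at h2
  constructor <;> linarith

lemma SatisfiesT2.integrable_wassersteinDist_empiricalDist {M : Type*} [MetricSpace M]
    [CompleteSpace M] [SecondCountableTopology M] [MeasurableSpace M] [BorelSpace M]
    {μ : Measure M} [IsProbabilityMeasure μ] {α : ℝ} (hT2 : SatisfiesT2 μ α) {N : ℕ} (hN : 1 ≤ N)
    {p : ℝ} (hp : p = 1 ∨ p = 2) :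
    Integrable (fun ξ : Fin N → M => (wassersteinDist p (empiricalDist ξ) μ).toReal)
      (Measure.pi fun _ : Fin N => μ) := by
  have hne : Nonempty M := nonempty_of_isProbabilityMeasure μ
  have x₀ : M := Classical.arbitrary M
  have hLip := hT2.abs_wassersteinDist_empiricalDist_sub_le hN hp
  have hsq : Integrable (fun y => dist y x₀ ^ 2) μ := by
    refine ⟨by fun_prop, ?_⟩
    rw [hasFiniteIntegral_iff_ofReal (Filter.Eventually.of_forall fun _ => by positivity)]
    have e : ∀ y, ENNReal.ofReal (dist y x₀ ^ 2) = edist x₀ y ^ (2 : ℝ) := fun y => by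
      rw [edist_dist, ENNReal.ofReal_rpow_of_nonneg dist_nonneg zero_le_two, dist_comm,
        Real.rpow_two]
    simp_rw [e]
    exact (hT2.lintegral_edist_sq_ne_top x₀).lt_top
  have hsum : Integrable (fun ξ : Fin N → M => (N : ℝ)⁻¹ * ∑ j, dist (ξ j) x₀ ^ 2)
      (Measure.pi fun _ : Fin N => μ) :=
    (integrable_finsetSum _ fun j _ => (measurePreserving_eval (fun _ : Fin N => μ)
      j).integrable_comp_of_integrable hsq).const_mul _
  refine ((integrable_const (1 + (wassersteinDist p
    (empiricalDist fun _ : Fin N => x₀) μ).toReal)).add hsum).mono'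
    (continuous_of_abs_sub_le_sqrt hLip).aestronglyMeasurable
    (Filter.Eventually.of_forall fun ξ => ?_)
  rw [Real.norm_of_nonneg ENNReal.toReal_nonneg]
  -- Comparison with the constant sample, whose distance to μ is a fixed finite number; √S ≤ 1 + S
  -- reduces integrability to that of d(·, x₀)².
  have h1 := (abs_le.1 (hLip ξ fun _ => x₀)).2
  set S := (N : ℝ)⁻¹ * ∑ j, dist (ξ j) x₀ ^ 2 with hS
  have hS0 : 0 ≤ S := by positivity
  have h2 : √S ≤ 1 + S := by
    rw [Real.sqrt_le_iff]
    constructor <;> nlinarith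
  simp only [Pi.add_apply]
  linarith

theorem mainTheorem4 {M : Type*} [MetricSpace M] [CompleteSpace M]
    [TopologicalSpace.SeparableSpace M] [MeasurableSpace M] [BorelSpace M]
    (μ : Measure M) [IsProbabilityMeasure μ]
    (α : ℝ) (hα : 0 < α) (hT2 : SatisfiesT2 μ α)
    (N : ℕ) (hN : 1 ≤ N) (p : ℝ) (hp : p = 1 ∨ p = 2) :
    (∀ ξ : Fin N → M, wassersteinDist p (empiricalDist ξ) μ ≠ ∞) ∧
    Integrable (fun ξ : Fin N → M => (wassersteinDist p (empiricalDist ξ) μ).toReal)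
      (Measure.pi fun _ : Fin N => μ) ∧
    ∀ ε : ℝ, 0 < ε →
      (Measure.pi fun _ : Fin N => μ)
        {ξ : Fin N → M |
          ε < |(wassersteinDist p (empiricalDist ξ) μ).toReal -
            ∫ η : Fin N → M, (wassersteinDist p (empiricalDist η) μ).toReal
              ∂(Measure.pi fun _ : Fin N => μ)|} ≤
        ENNReal.ofReal (2 * Real.exp (-((N : ℝ) * α * ε ^ 2 / 2))) := by
  have : SecondCountableTopology M := UniformSpace.secondCountable_of_separable M
  have hint := hT2.integrable_wassersteinDist_empiricalDist hN hp
  refine ⟨hT2.wassersteinDist_empiricalDist_ne_top hN hp, hint, fun ε hε => ?_⟩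
  have hN0 : (0 : ℝ) < N := by exact_mod_cast hN
  -- The squared Lipschitz constant is L = 1/N.
  have e : -((N : ℝ) * α * ε ^ 2 / 2) = -ε ^ 2 / (2 * ((N : ℝ)⁻¹ / α)) := by
    field_simp
  rw [e]
  exact (hT2.infConvolutionInequality hα).measure_abs_sub_integral_gt_le hα
    (fun _ => ENNReal.toReal_nonneg) hint (by positivity)
    (hT2.abs_wassersteinDist_empiricalDist_sub_le hN hp) hε
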